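/- Let $\mu\ge 1$ be an integer and let $0<a\le 1$. For $0<q<1$, real $x$ and $s\in\mathbb{C}$ put $[x]_q=\frac{1-q^x}{1-q}$ and $$g_q(s,\mu,a)=\sum_{n=0}^{\infty}\frac{q^{\mu(n+a)}}{[n+a]_q^{\,s}},$$ a series which converges absolutely for every $s\in\mathbb{C}$. With the rising factorial $(x)_\mu=x(x+1)\cdots(x+\mu-1)$, let $$\zeta_q^{\mu}(s,a)=\frac{(\mu-1)!}{(1-s)_\mu}\,\frac{(1-q)^s}{\log q}+g_q(s,\mu,a) =\frac{(-1)^{\mu}(\mu-1)!}{(s-1)\cdots(s-\mu)}\,\frac{(1-q)^s}{\log q}+\sum_{n=0}^{\infty}\frac{q^{\mu(n+a)}}{[n+a]_q^{\,s}}.$$ Then, for each $0<q<1$, the function $s\mapsto\zeta_q^{\mu}(s,a)$ is meromorphic on $\mathbb{C}$, has simple poles at $s=1,2,\ldots,\mu$, and is holomorphic elsewhere. Moreover, $$\lim_{q\uparrow 1}\zeta_q^{\mu}(s,a)=\zeta(s,a)\qquad\text{for all } s\in\mathbb{C}\setminus\{1,2,\ldots,\mu\},$$ where $\zeta(s,a)$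 is the Hurwitz zeta function, i.e. the meromorphic continuation to $\mathbb{C}$ of $\sum_{n=0}^{\infty}(n+a)^{-s}$ $(\Re(s)>1)$. -/

import Mathlib

open Filter Topology

noncomputable section

/-- The `q`-number `[x]_q = (1 - q^x) / (1 - q)` for real `x`, where `0 < q < 1`. -/
def qNumber (q x : ℝ) : ℝ := (1 - q ^ x) / (1 - q)

/-- The `n`-th term `q^{(n+a)t} / [n+a]_q^s` of the series for `g_q(s,t,a)`. For `0 < q < 1` and
`0 < a` the bases `q` and `[n+a]_q` are positive reals, so the principal powers are the usual
ones. -/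
def qHurwitzTerm (q : ℝ) (s t : ℂ) (a : ℝ) (n : ℕ) : ℂ :=
  (q : ℂ) ^ (((n : ℂ) + (a : ℂ)) * t) / ((qNumber q ((n : ℝ) + a) : ℝ) : ℂ) ^ s

/-- The series `g_q(s,t,a) = ∑_{n ≥ 0} q^{(n+a)t} / [n+a]_q^s` (for `Re t > 0`). -/
def qHurwitz (q : ℝ) (s t : ℂ) (a : ℝ) : ℂ :=
  ∑' n : ℕ, qHurwitzTerm q s t a n

/-- `ζ_q^μ(s,a) = (μ-1)! / (1-s)_μ * (1-q)^s / log q + g_q(s,μ,a)`, where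
`(x)_μ = x (x+1) ⋯ (x+μ-1)` is the rising factorial. -/
def qHurwitzZeta (q : ℝ) (μ : ℕ) (s : ℂ) (a : ℝ) : ℂ :=
  ((μ - 1).factorial : ℂ) / (ascPochhammer ℂ μ).eval (1 - s) *
      (((1 - q : ℝ) : ℂ) ^ s / ((Real.log q : ℝ) : ℂ)) +
    qHurwitz q s (μ : ℂ) a

end

/-! For fixed `q` the series decays like `q ^ n` locally uniformly in `s`, hence is entire; every
pole comes from the product in the denominator of the correction term.

For the limit take `μ = 1` and the entire function `Z_q(s,x) = (s-1) ζ_q^1(s,x)` (`qZetaNumer`). On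
`Re s ≥ 2` dominated convergence suffices. Elsewhere convergence is propagated by a Vitali argument,
which needs bounds uniform in `q` near 1. These rest on two identities: `∂Z_q(s,x)/∂x` is a
combination of `Z_q(s+1,x)` and `Z_q(s,x)` (`hasDerivAt_qZetaNumer`), and the mean of `Z_q(s,·)`
over `[a,a+1]` telescopes to a closed form (`integral_qZetaNumer`). A function is controlled by its
mean and its derivative, so a bound at `s+1` yields one at `s` (`norm_qZetaNumer_le_of_shift`), and
induction reaches every half-plane.

For general `μ`, the identity `q^y = 1 - (1-q)[y]_q` gives `ζ_q^{μ+1}(s) = ζ_q^μ(s) - (1-q)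
ζ_q^μ(s-1)`, whose last term vanishes in the limit. -/

/-! ### Estimates for `q`-numbers -/

lemma qNumber_pos {q x : ℝ} (hq0 : 0 < q) (hq1 : q < 1) (hx : 0 < x) : 0 < qNumber q x :=
  div_pos (sub_pos.2 (Real.rpow_lt_one hq0.le hq1 hx)) (sub_pos.2 hq1)

lemma qNumber_mono {q x y : ℝ} (hq0 : 0 < q) (hq1 : q < 1) (hxy : x ≤ y) :
    qNumber q x ≤ qNumber q y := by
  unfold qNumber
  have := Real.rpow_le_rpow_of_exponent_ge hq0 hq1.le hxy
  have h1 := sub_pos.2 hq1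
  gcongr

/-- Bernoulli's inequality for `(1 + (q - 1)) ^ x` with exponent in `[0,1]`. It gives a lower bound
independent of `q`. -/
lemma le_qNumber {q x : ℝ} (hq0 : 0 < q) (hq1 : q < 1) (hx0 : 0 ≤ x) (hx1 : x ≤ 1) :
    x ≤ qNumber q x := by
  rw [qNumber, le_div_iff₀ (sub_pos.2 hq1)]
  have := rpow_one_add_le_one_add_mul_self (s := q - 1) (by linarith) hx0 hx1
  rw [add_sub_cancel] at this
  linarith

lemma qNumber_lt {q x : ℝ} (hq0 : 0 < q) (hq1 : q < 1) : qNumber q x < (1 - q)⁻¹ := by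
  rw [qNumber, div_eq_mul_inv]
  have h1 := inv_pos.2 (sub_pos.2 hq1)
  have := Real.rpow_pos_of_pos hq0 x
  nlinarith

lemma qNumber_one {q : ℝ} (hq1 : q < 1) : qNumber q 1 = 1 := by
  rw [qNumber, Real.rpow_one, div_self (sub_pos.2 hq1).ne']

lemma one_sub_le_neg_log {q : ℝ} (hq0 : 0 < q) : 1 - q ≤ -Real.log q := by
  linarith [Real.log_le_sub_one_of_pos hq0]

lemma neg_log_le {q : ℝ} (hq0 : 0 < q) : -Real.log q ≤ (1 - q) / q := by
  have := Real.one_sub_inv_le_log_of_pos hq0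
  have h : (1 - q) / q = q⁻¹ - 1 := by field_simp
  linarith

/-- With `q = e^{-l}`, one has `q^{-y/2} (1 - q^y) = 2 sinh(ly/2) ≥ ly ≥ (1-q)y`. Its square
provides the majorant `1 / y ^ 2`, uniform in `q`. -/
lemma mul_rpow_half_le_qNumber {q y : ℝ} (hq0 : 0 < q) (hq1 : q < 1) (hy : 0 ≤ y) :
    y * q ^ (y / 2) ≤ qNumber q y := by
  have h1 := sub_pos.2 hq1
  rw [qNumber, le_div_iff₀ h1]
  set l := -Real.log q with hl
  have hlpos : 1 - q ≤ l := one_sub_le_neg_log hq0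
  have e : ∀ z : ℝ, q ^ z = Real.exp (-(l * z)) := fun z => by
    rw [Real.rpow_def_of_pos hq0, hl]; ring_nf
  have hs := Real.self_le_sinh_iff.2 (show 0 ≤ l * y / 2 from div_nonneg (mul_nonneg (h1.le.trans hlpos) hy) two_pos.le)
  rw [Real.sinh_eq] at hs
  have hp := Real.exp_pos (-(l * (y / 2)))
  have e1 : Real.exp (-(l * (y / 2))) * Real.exp (l * y / 2) = 1 := by
    rw [← Real.exp_add]; ring_nf; simp
  have e2 : Real.exp (-(l * (y / 2))) * Real.exp (-(l * y / 2)) = Real.exp (-(l * y)) := by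
    rw [← Real.exp_add]; ring_nf
  rw [e, e]
  have h3 : Real.exp (-(l * (y / 2))) * (l * y) ≤ 1 - Real.exp (-(l * y)) := by
    rw [← e2, ← e1, ← mul_sub]
    exact mul_le_mul_of_nonneg_left (by linarith) hp.le
  have h4 : Real.exp (-(l * (y / 2))) * ((1 - q) * y) ≤ Real.exp (-(l * (y / 2))) * (l * y) := by
    gcongr
  linarith

lemma hasDerivAt_rpow_exponent {q : ℝ} (hq0 : 0 < q) (x : ℝ) :
    HasDerivAt (fun y : ℝ => q ^ y) (Real.log q * q ^ x) x := by
  simpa [mul_comm] using (Real.hasStrictDerivAt_const_rpow hq0 x).hasDerivAt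

lemma hasDerivAt_qNumber {q : ℝ} (hq0 : 0 < q) (x : ℝ) :
    HasDerivAt (qNumber q) (-Real.log q / (1 - q) * q ^ x) x := by
  have := ((hasDerivAt_rpow_exponent hq0 x).const_sub 1).div_const (1 - q)
  refine this.congr_deriv ?_
  ring

lemma tendsto_qNumber (x : ℝ) : Tendsto (fun q => qNumber q x) (𝓝[<] 1) (𝓝 x) := by
  have h : HasDerivAt (fun t : ℝ => t ^ x) x 1 := by
    simpa using Real.hasDerivAt_rpow_const (x := 1) (p := x) (Or.inl one_ne_zero)
  have := (hasDerivAt_iff_tendsto_slope.1 h).mono_left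
    (nhdsWithin_mono (1 : ℝ) (fun q (hq : q < 1) => ne_of_lt hq) : 𝓝[<] (1 : ℝ) ≤ 𝓝[≠] 1)
  refine this.congr' ?_
  filter_upwards [self_mem_nhdsWithin] with q (hq : q < 1)
  rw [slope_def_field, qNumber, Real.one_rpow, ← neg_sub, ← neg_sub (1 : ℝ) q, neg_div_neg_eq]

/-! ### Convergence and holomorphy of the series for fixed `q` -/

lemma rpow_le_rpow_of_inv_le {T y p ρ : ℝ} (hT : 1 ≤ T) (h1 : T⁻¹ ≤ y) (h2 : y ≤ T)
    (hp : |p| ≤ ρ) : y ^ p ≤ T ^ ρ := by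
  have hT0 : 0 < T := one_pos.trans_le hT
  have hy : 0 < y := (inv_pos.2 hT0).trans_le h1
  have hp' := abs_le.1 hp
  rcases le_total 0 p with h | h
  · exact (Real.rpow_le_rpow hy.le h2 h).trans (Real.rpow_le_rpow_of_exponent_le hT hp'.2)
  · calc y ^ p ≤ T⁻¹ ^ p := Real.rpow_le_rpow_of_nonpos (inv_pos.2 hT0) h1 h
      _ = T ^ (-p) := by rw [Real.inv_rpow hT0.le, Real.rpow_neg hT0.le]
      _ ≤ T ^ ρ := Real.rpow_le_rpow_of_exponent_le hT (by linarith)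

lemma norm_qNumber_cpow_inv_le {q b y ρ : ℝ} {s : ℂ} (hq0 : 0 < q) (hq1 : q < 1) (hb0 : 0 < b)
    (hb1 : b ≤ 1) (hy : b ≤ y) (hs : ‖s‖ ≤ ρ) :
    ‖(((qNumber q y : ℝ) : ℂ) ^ s)⁻¹‖ ≤ (b * (1 - q))⁻¹ ^ ρ := by
  have h1 := sub_pos.2 hq1
  have hp := qNumber_pos hq0 hq1 (hb0.trans_le hy)
  rw [norm_inv, Complex.norm_cpow_eq_rpow_re_of_pos hp, ← Real.rpow_neg hp.le]
  have hle : b * (1 - q) ≤ 1 := mul_le_one₀ hb1 h1.le (by linarith)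
  have hbq := (le_qNumber hq0 hq1 hb0.le hb1).trans (qNumber_mono hq0 hq1 hy)
  refine rpow_le_rpow_of_inv_le ((one_le_inv₀ (by positivity)).2 hle) ?_ ?_ ?_
  · rw [inv_inv]
    exact le_trans (mul_le_of_le_one_right hb0.le (by linarith)) hbq
  · refine (qNumber_lt hq0 hq1).le.trans ?_
    rw [mul_inv]
    exact le_mul_of_one_le_left (inv_pos.2 h1).le ((one_le_inv₀ hb0).2 hb1)
  · rw [abs_neg]; exact (Complex.abs_re_le_norm s).trans hs

lemma qHurwitzTerm_natCast {q : ℝ} (hq0 : 0 < q) (s : ℂ) (μ : ℕ) (x : ℝ) (n : ℕ) :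
    qHurwitzTerm q s (μ : ℂ) x n =
      ((q ^ ((n : ℝ) + x) : ℝ) : ℂ) ^ μ * (((qNumber q ((n : ℝ) + x) : ℝ) : ℂ) ^ s)⁻¹ := by
  rw [qHurwitzTerm, div_eq_mul_inv, Complex.cpow_mul_nat, Complex.ofReal_cpow hq0.le]
  push_cast
  rfl

/-- The `q`-numbers stay between `b` and `1/(1-q)`, so only the factor `q ^ n` matters. The bound is
uniform in `s` and `x` but degenerates as `q → 1`. -/
lemma norm_qHurwitzTerm_le {q b x ρ : ℝ} {s : ℂ} {μ : ℕ} (hμ : 1 ≤ μ) (hq0 : 0 < q) (hq1 : q < 1)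
    (hb0 : 0 < b) (hb1 : b ≤ 1) (hx : b ≤ x) (hs : ‖s‖ ≤ ρ) (n : ℕ) :
    ‖qHurwitzTerm q s (μ : ℂ) x n‖ ≤ q ^ n * (b * (1 - q))⁻¹ ^ ρ := by
  rw [qHurwitzTerm_natCast hq0, norm_mul]
  have hn : (0 : ℝ) ≤ n := n.cast_nonneg
  refine mul_le_mul ?_ (norm_qNumber_cpow_inv_le hq0 hq1 hb0 hb1 (by linarith) hs)
    (norm_nonneg _) (by positivity)
  have h0 : 0 ≤ q ^ ((n : ℝ) + x) := Real.rpow_nonneg hq0.le _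
  rw [norm_pow, Complex.norm_real, Real.norm_of_nonneg h0]
  have h1 : q ^ ((n : ℝ) + x) ≤ q ^ n := by
    rw [← Real.rpow_natCast]
    exact Real.rpow_le_rpow_of_exponent_ge hq0 hq1.le (by linarith)
  exact (pow_le_of_le_one h0 (h1.trans (pow_le_one₀ hq0.le hq1.le)) (by omega)).trans h1

lemma summable_pow_mul {q : ℝ} (hq0 : 0 < q) (hq1 : q < 1) (C : ℝ) :
    Summable fun n : ℕ => q ^ n * C :=
  (summable_geometric_of_lt_one hq0.le hq1).mul_right C

lemma summable_norm_qHurwitzTerm {q x : ℝ} {μ : ℕ} (hμ : 1 ≤ μ) (hq0 : 0 < q) (hq1 : q < 1)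
    (hx : 0 < x) (s : ℂ) : Summable fun n : ℕ => ‖qHurwitzTerm q s (μ : ℂ) x n‖ :=
  (summable_pow_mul hq0 hq1 _).of_nonneg_of_le (fun _ => norm_nonneg _)
    (norm_qHurwitzTerm_le hμ hq0 hq1 (lt_min hx one_pos) (min_le_right x 1) (min_le_left x 1) le_rfl)

lemma differentiable_qHurwitz {q x : ℝ} {μ : ℕ} (hμ : 1 ≤ μ) (hq0 : 0 < q) (hq1 : q < 1)
    (hx : 0 < x) : Differentiable ℂ fun s => qHurwitz q s (μ : ℂ) x := by
  intro s₀
  have : DifferentiableOn ℂ (fun s => ∑' n, qHurwitzTerm q s (μ : ℂ) x n)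
      (Metric.ball 0 (‖s₀‖ + 1)) := by
    refine Complex.differentiableOn_tsum_of_summable_norm
      (summable_pow_mul hq0 hq1 _) (fun n => ?_) Metric.isOpen_ball
      (fun n s hs => norm_qHurwitzTerm_le hμ hq0 hq1 (lt_min hx one_pos) (min_le_right x 1)
        (min_le_left x 1) (by simpa using (Metric.mem_ball.1 hs).le) n)
    have hp : ((qNumber q ((n : ℝ) + x) : ℝ) : ℂ) ≠ 0 :=
      Complex.ofReal_ne_zero.2 (qNumber_pos hq0 hq1 (by positivity)).ne'
    refine Differentiable.differentiableOn fun s => ?_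
    unfold qHurwitzTerm
    refine (differentiableAt_const _).div (differentiableAt_id.const_cpow (Or.inl hp)) ?_
    simp [Complex.cpow_eq_zero_iff, hp]
  exact (this.differentiableAt (Metric.isOpen_ball.mem_nhds (by simp)))

/-! ### Poles and meromorphy -/

lemma ascPochhammer_eval_one_sub (μ : ℕ) (s : ℂ) :
    (ascPochhammer ℂ μ).eval (1 - s) = (-1) ^ μ * ∏ k ∈ Finset.Icc 1 μ, (s - (k : ℂ)) := by
  induction μ with
  | zero => simp
  | succ m ih =>
    rw [ascPochhammer_succ_eval, ih, Finset.prod_Icc_succ_top (by omega)]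
    push_cast
    ring

lemma qHurwitzZeta_eq_prod (q : ℝ) (μ : ℕ) (s : ℂ) (a : ℝ) :
    qHurwitzZeta q μ s a =
      (-1 : ℂ) ^ μ * ((μ - 1).factorial : ℂ) / (∏ k ∈ Finset.Icc 1 μ, (s - (k : ℂ))) *
        (((1 - q : ℝ) : ℂ) ^ s / ((Real.log q : ℝ) : ℂ)) + qHurwitz q s (μ : ℂ) a := by
  rw [qHurwitzZeta, ascPochhammer_eval_one_sub]
  congr 2
  rcases neg_one_pow_eq_or ℂ μ with h | h <;> simp [h, neg_div, div_neg]

lemma prod_sub_natCast_ne_zero {μ : ℕ} {s : ℂ} (hs : ∀ k ∈ Finset.Icc 1 μ, s ≠ (k : ℂ)) :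
    ∏ k ∈ Finset.Icc 1 μ, (s - (k : ℂ)) ≠ 0 :=
  Finset.prod_ne_zero_iff.2 fun k hk => sub_ne_zero.2 (hs k hk)

lemma differentiable_cpow_div_log {q : ℝ} (hq1 : q < 1) :
    Differentiable ℂ fun s : ℂ => ((1 - q : ℝ) : ℂ) ^ s / ((Real.log q : ℝ) : ℂ) := fun _ =>
  (differentiableAt_id.const_cpow
    (Or.inl (Complex.ofReal_ne_zero.2 (sub_pos.2 hq1).ne'))).div_const _

lemma analyticAt_qHurwitzZeta {q a : ℝ} {μ : ℕ} (hμ : 1 ≤ μ) (hq0 : 0 < q) (hq1 : q < 1)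
    (ha : 0 < a) {s : ℂ} (hs : ∀ k ∈ Finset.Icc 1 μ, s ≠ (k : ℂ)) :
    AnalyticAt ℂ (fun s => qHurwitzZeta q μ s a) s := by
  simp only [qHurwitzZeta_eq_prod]
  have hp : Differentiable ℂ fun s : ℂ => ∏ k ∈ Finset.Icc 1 μ, (s - (k : ℂ)) := by fun_prop
  exact ((analyticAt_const.div (hp.analyticAt s) (prod_sub_natCast_ne_zero hs)).mul
    ((differentiable_cpow_div_log hq1).analyticAt s)).add
    ((differentiable_qHurwitz hμ hq0 hq1 ha).analyticAt s)

lemma meromorphicOrderAt_qHurwitzZeta {q a : ℝ} {μ k : ℕ} (hμ : 1 ≤ μ) (hq0 : 0 < q) (hq1 : q < 1)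
    (ha : 0 < a) (hk : k ∈ Finset.Icc 1 μ) :
    meromorphicOrderAt (fun s => qHurwitzZeta q μ s a) (k : ℂ) = ((-1 : ℤ) : WithTop ℤ) := by
  have hp : Differentiable ℂ fun s : ℂ => ∏ j ∈ (Finset.Icc 1 μ).erase k, (s - (j : ℂ)) := by
    fun_prop
  have hpk : ∏ j ∈ (Finset.Icc 1 μ).erase k, ((k : ℂ) - (j : ℂ)) ≠ 0 :=
    Finset.prod_ne_zero_iff.2 fun j hj =>
      sub_ne_zero.2 (by exact_mod_cast (Finset.ne_of_mem_erase hj).symm)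
  -- `G` is `(s - k) ζ_q^μ(s,a)` with the factor `s - k` cancelled from the product. At `k` the
  -- entire series drops out and a nonzero residue remains.
  let G : ℂ → ℂ := fun s => (-1 : ℂ) ^ μ * ((μ - 1).factorial : ℂ) /
    (∏ j ∈ (Finset.Icc 1 μ).erase k, (s - (j : ℂ))) *
      (((1 - q : ℝ) : ℂ) ^ s / ((Real.log q : ℝ) : ℂ)) + (s - k) * qHurwitz q s (μ : ℂ) a
  have hG : AnalyticAt ℂ G k :=
    ((analyticAt_const.div (hp.analyticAt _) hpk).mul
      ((differentiable_cpow_div_log hq1).analyticAt _)).add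
      ((analyticAt_id.sub analyticAt_const).mul
        ((differentiable_qHurwitz hμ hq0 hq1 ha).analyticAt _))
  have hGk : G k ≠ 0 := by
    have h1 : ((1 - q : ℝ) : ℂ) ≠ 0 := Complex.ofReal_ne_zero.2 (sub_pos.2 hq1).ne'
    have h2 : ((Real.log q : ℝ) : ℂ) ≠ 0 := Complex.ofReal_ne_zero.2 (Real.log_neg hq0 hq1).ne
    have h3 : ((μ - 1).factorial : ℂ) ≠ 0 := by exact_mod_cast (μ - 1).factorial_ne_zero
    simp only [G, sub_self, zero_mul, add_zero]
    refine mul_ne_zero (div_ne_zero (mul_ne_zero (by simp) h3) hpk) (div_ne_zero ?_ h2)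
    exact fun h => h1 ((Complex.cpow_eq_zero_iff _ _).1 h).1
  have hEq : ∀ᶠ s in 𝓝[≠] (k : ℂ), qHurwitzZeta q μ s a = (s - k) ^ (-1 : ℤ) • G s := by
    filter_upwards [self_mem_nhdsWithin] with s hs
    have hsk : s - k ≠ 0 := sub_ne_zero.2 hs
    rw [qHurwitzZeta_eq_prod, ← Finset.mul_prod_erase _ _ hk, zpow_neg_one, smul_eq_mul]
    simp only [G, mul_add, inv_mul_cancel_left₀ hsk]
    congr 1
    rw [← mul_assoc, div_eq_mul_inv, div_eq_mul_inv _ (∏ j ∈ (Finset.Icc 1 μ).erase k, _), mul_inv]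
    ring
  have hm : MeromorphicAt (fun s => qHurwitzZeta q μ s a) (k : ℂ) :=
    (((MeromorphicAt.id _).sub (MeromorphicAt.const _ _)).zpow (-1) |>.smul hG.meromorphicAt).congr
      (hEq.mono fun s hs => hs.symm)
  exact (meromorphicOrderAt_eq_int_iff hm).2 ⟨G, hG, hGk, hEq⟩

lemma meromorphic_qHurwitzZeta {q a : ℝ} {μ : ℕ} (hμ : 1 ≤ μ) (hq0 : 0 < q) (hq1 : q < 1)
    (ha : 0 < a) : Meromorphic fun s => qHurwitzZeta q μ s a := by
  intro s
  by_cases hs : ∀ k ∈ Finset.Icc 1 μ, s ≠ (k : ℂ)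
  · exact (analyticAt_qHurwitzZeta hμ hq0 hq1 ha hs).meromorphicAt
  · push Not at hs
    obtain ⟨k, hk, rfl⟩ := hs
    -- The order defaults to 0 where a function is not meromorphic, so order `-1` already forces
    -- meromorphy.
    refine meromorphicAt_of_meromorphicOrderAt_ne_zero ?_
    rw [meromorphicOrderAt_qHurwitzZeta hμ hq0 hq1 ha hk]
    exact fun h => by simpa using WithTop.coe_injective h

/-! ### The case `μ = 1`: differentiation in the shift parameter -/

/-- The summand `q^y / [y]_q^s` of `g_q(s,1,a)` as a function of a real variable `y`. -/
noncomputable def qSummand (q : ℝ) (s : ℂ) (y : ℝ) : ℂ :=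
  ((q ^ y : ℝ) : ℂ) * (((qNumber q y : ℝ) : ℂ) ^ s)⁻¹

lemma qHurwitzTerm_one {q : ℝ} (hq0 : 0 < q) (s : ℂ) (x : ℝ) (n : ℕ) :
    qHurwitzTerm q s ((1 : ℕ) : ℂ) x n = qSummand q s (n + x) := by
  rw [qHurwitzTerm_natCast hq0, pow_one, qSummand]

lemma qHurwitz_one {q : ℝ} (hq0 : 0 < q) (s : ℂ) (x : ℝ) :
    qHurwitz q s ((1 : ℕ) : ℂ) x = ∑' n : ℕ, qSummand q s (n + x) :=
  tsum_congr fun n => qHurwitzTerm_one hq0 s x n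

lemma norm_qSummand_add_le {q b x ρ : ℝ} {s : ℂ} (hq0 : 0 < q) (hq1 : q < 1)
    (hb0 : 0 < b) (hb1 : b ≤ 1) (hx : b ≤ x) (hs : ‖s‖ ≤ ρ) (n : ℕ) :
    ‖qSummand q s (n + x)‖ ≤ q ^ n * (b * (1 - q))⁻¹ ^ ρ := by
  rw [← qHurwitzTerm_one hq0]
  exact norm_qHurwitzTerm_le le_rfl hq0 hq1 hb0 hb1 hx hs n

lemma summable_qSummand {q x : ℝ} (hq0 : 0 < q) (hq1 : q < 1) (hx : 0 < x) (s : ℂ) :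
    Summable fun n : ℕ => qSummand q s (n + x) := by
  simp only [← qHurwitzTerm_one hq0]
  exact (summable_norm_qHurwitzTerm le_rfl hq0 hq1 hx s).of_norm

lemma hasDerivAt_qNumber_cpow {q y : ℝ} (hq0 : 0 < q) (hq1 : q < 1) (hy : 0 < y) (s : ℂ) :
    HasDerivAt (fun y : ℝ => ((qNumber q y : ℝ) : ℂ) ^ s)
      (s * ((qNumber q y : ℝ) : ℂ) ^ (s - 1) * ((-Real.log q / (1 - q) * q ^ y : ℝ) : ℂ)) y := by
  have h := (hasDerivAt_id ((qNumber q y : ℝ) : ℂ)).cpow_const (c := s)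
    (Complex.ofReal_mem_slitPlane.2 (qNumber_pos hq0 hq1 hy))
  exact (HasDerivAt.comp_of_eq y h (hasDerivAt_qNumber hq0 y).ofReal_comp rfl).congr_deriv
    (by rw [mul_one, id])

/-- The chain rule produces a second factor `q^y`; replacing it by `1 - (1-q)[y]_q` leaves only
summands with parameters `s` and `s + 1`. -/
lemma hasDerivAt_qSummand {q y : ℝ} (hq0 : 0 < q) (hq1 : q < 1) (hy : 0 < y) (s : ℂ) :
    HasDerivAt (qSummand q s)
      (((Real.log q : ℝ) : ℂ) * ((1 - s) * qSummand q s y +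
        s / ((1 - q : ℝ) : ℂ) * qSummand q (s + 1) y)) y := by
  have h := (hasDerivAt_rpow_exponent hq0 y).ofReal_comp.mul
    (hasDerivAt_qNumber_cpow hq0 hq1 hy (-s))
  have hp : ((qNumber q y : ℝ) : ℂ) ≠ 0 := Complex.ofReal_ne_zero.2 (qNumber_pos hq0 hq1 hy).ne'
  have h1 : ((1 - q : ℝ) : ℂ) ≠ 0 := Complex.ofReal_ne_zero.2 (sub_pos.2 hq1).ne'
  have hf : qSummand q s = (fun y : ℝ => ((q ^ y : ℝ) : ℂ)) *
      fun y : ℝ => ((qNumber q y : ℝ) : ℂ) ^ (-s) := by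
    funext z; simp only [qSummand, Complex.cpow_neg, Pi.mul_apply]
  have hqy : ((q ^ y : ℝ) : ℂ) = 1 - ((1 - q : ℝ) : ℂ) * ((qNumber q y : ℝ) : ℂ) := by
    have : q ^ y = 1 - (1 - q) * qNumber q y := by
      rw [qNumber, mul_div_cancel₀ _ (sub_pos.2 hq1).ne']; ring
    exact_mod_cast congrArg (fun r : ℝ => (r : ℂ)) this
  rw [hf]
  refine h.congr_deriv ?_
  rw [← hf]
  have e1 : ((qNumber q y : ℝ) : ℂ) ^ (-s) = ((qNumber q y : ℝ) : ℂ) *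
      (((qNumber q y : ℝ) : ℂ) ^ (s + 1))⁻¹ := by
    rw [Complex.cpow_neg, Complex.cpow_add _ _ hp, Complex.cpow_one]
    field_simp
  have e2 : ((qNumber q y : ℝ) : ℂ) ^ (-s - 1) = (((qNumber q y : ℝ) : ℂ) ^ (s + 1))⁻¹ := by
    rw [← Complex.cpow_neg]; congr 1; ring
  have e3 : (((qNumber q y : ℝ) : ℂ) ^ s)⁻¹ = ((qNumber q y : ℝ) : ℂ) *
      (((qNumber q y : ℝ) : ℂ) ^ (s + 1))⁻¹ := by rw [← e1, Complex.cpow_neg]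
  have e4 : ((-Real.log q / (1 - q) * q ^ y : ℝ) : ℂ) =
      -((Real.log q : ℝ) : ℂ) / ((1 - q : ℝ) : ℂ) * ((q ^ y : ℝ) : ℂ) := by push_cast; rfl
  have e5 : ((Real.log q * q ^ y : ℝ) : ℂ) = ((Real.log q : ℝ) : ℂ) * ((q ^ y : ℝ) : ℂ) := by
    push_cast; rfl
  simp only [qSummand]
  rw [e1, e2, e3, e4, e5, hqy]
  generalize (((qNumber q y : ℝ) : ℂ) ^ (s + 1))⁻¹ = A
  generalize ((qNumber q y : ℝ) : ℂ) = N
  generalize ((1 - q : ℝ) : ℂ) = Q at *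
  generalize ((Real.log q : ℝ) : ℂ) = L
  field_simp
  ring

lemma hasDerivAt_qHurwitz_one {q x : ℝ} (hq0 : 0 < q) (hq1 : q < 1) (hx : 0 < x) (s : ℂ) :
    HasDerivAt (fun x => qHurwitz q s ((1 : ℕ) : ℂ) x)
      (((Real.log q : ℝ) : ℂ) * ((1 - s) * qHurwitz q s ((1 : ℕ) : ℂ) x +
        s / ((1 - q : ℝ) : ℂ) * qHurwitz q (s + 1) ((1 : ℕ) : ℂ) x)) x := by
  simp only [qHurwitz_one hq0]
  -- Termwise differentiation takes place on `(b, ∞)`, where the geometric majorant is uniform.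
  obtain ⟨b, hb0, hb⟩ : ∃ b : ℝ, 0 < b ∧ b < min x 1 := exists_between (lt_min hx one_pos)
  have hb1 : b ≤ 1 := (hb.trans_le (min_le_right _ _)).le
  have hbx : b < x := hb.trans_le (min_le_left _ _)
  set C := (b * (1 - q))⁻¹ ^ ‖s‖
  set D := (b * (1 - q))⁻¹ ^ ‖s + 1‖
  have key := hasDerivAt_tsum_of_isPreconnected
    (u := fun n : ℕ => q ^ n * (‖((Real.log q : ℝ) : ℂ)‖ *
      (‖1 - s‖ * C + ‖s / ((1 - q : ℝ) : ℂ)‖ * D)))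
    (g := fun (n : ℕ) (x : ℝ) => qSummand q s (n + x))
    (g' := fun n x => ((Real.log q : ℝ) : ℂ) * ((1 - s) * qSummand q s (n + x) +
        s / ((1 - q : ℝ) : ℂ) * qSummand q (s + 1) (n + x)))
    (summable_pow_mul hq0 hq1 _) isOpen_Ioi isPreconnected_Ioi
    (fun n y (hy : b < y) =>
      (hasDerivAt_qSummand hq0 hq1 (add_pos_of_nonneg_of_pos n.cast_nonneg (hb0.trans hy))
        s).comp_const_add (n : ℝ) y) ?_ (show x ∈ Set.Ioi b from hbx)
    (summable_qSummand hq0 hq1 hx s) hbx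
  · refine key.congr_deriv ?_
    rw [tsum_mul_left, Summable.tsum_add, tsum_mul_left, tsum_mul_left]
    · exact (summable_qSummand hq0 hq1 hx _).mul_left _
    · exact (summable_qSummand hq0 hq1 hx _).mul_left _
  · intro n y (hy : b < y)
    rw [norm_mul]
    have h1 := norm_qSummand_add_le hq0 hq1 hb0 hb1 hy.le (le_refl ‖s‖) n
    have h2 := norm_qSummand_add_le hq0 hq1 hb0 hb1 hy.le (le_refl ‖s + 1‖) n
    calc _ ≤ ‖((Real.log q : ℝ) : ℂ)‖ * (‖1 - s‖ * (q ^ n * C) +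
          ‖s / ((1 - q : ℝ) : ℂ)‖ * (q ^ n * D)) := by
          gcongr
          refine (norm_add_le _ _).trans ?_
          rw [norm_mul, norm_mul]
          gcongr
      _ = _ := by ring

/-- `(s - 1) ζ_q^1(s, x)`, with the removable singularity at `s = 1` removed. -/
noncomputable def qZetaNumer (q : ℝ) (s : ℂ) (x : ℝ) : ℂ :=
  (s - 1) * qHurwitz q s ((1 : ℕ) : ℂ) x - ((1 - q : ℝ) : ℂ) ^ s / ((Real.log q : ℝ) : ℂ)

lemma differentiable_qZetaNumer {q x : ℝ} (hq0 : 0 < q) (hq1 : q < 1) (hx : 0 < x) :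
    Differentiable ℂ fun s => qZetaNumer q s x :=
  ((differentiable_id.sub_const 1).mul (differentiable_qHurwitz le_rfl hq0 hq1 hx)).sub
    (differentiable_cpow_div_log hq1)

lemma qZetaNumer_eq (q x : ℝ) {s : ℂ} (hs : s ≠ 1) :
    qZetaNumer q s x = (s - 1) * qHurwitzZeta q 1 s x := by
  have : s - 1 ≠ 0 := sub_ne_zero.2 hs
  rw [qHurwitzZeta_eq_prod, qZetaNumer]
  simp
  field_simp
  ring

/-- The correction terms of `Z_q(s+1,x) / (1-q)` and `Z_q(s,x)` are equal and cancel. This is the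
`q`-analogue of `∂ζ(s,x)/∂x = -s ζ(s+1,x)`. -/
lemma hasDerivAt_qZetaNumer {q x : ℝ} (hq0 : 0 < q) (hq1 : q < 1) (hx : 0 < x) (s : ℂ) :
    HasDerivAt (fun x => qZetaNumer q s x)
      ((s - 1) * ((Real.log q : ℝ) : ℂ) *
        (qZetaNumer q (s + 1) x / ((1 - q : ℝ) : ℂ) - qZetaNumer q s x)) x := by
  have h1 : ((1 - q : ℝ) : ℂ) ≠ 0 := Complex.ofReal_ne_zero.2 (sub_pos.2 hq1).ne'
  have h2 : ((Real.log q : ℝ) : ℂ) ≠ 0 := Complex.ofReal_ne_zero.2 (Real.log_neg hq0 hq1).ne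
  refine (((hasDerivAt_qHurwitz_one hq0 hq1 hx s).const_mul (s - 1)).sub_const
    (((1 - q : ℝ) : ℂ) ^ s / ((Real.log q : ℝ) : ℂ))).congr_deriv ?_
  rw [qZetaNumer, qZetaNumer, Complex.cpow_add _ _ h1, Complex.cpow_one]
  generalize ((1 - q : ℝ) : ℂ) ^ s = A
  generalize qHurwitz q s ((1 : ℕ) : ℂ) x = X
  generalize qHurwitz q (s + 1) ((1 : ℕ) : ℂ) x = Y
  generalize ((1 - q : ℝ) : ℂ) = Q at *
  generalize ((Real.log q : ℝ) : ℂ) = L at *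
  field_simp
  ring

/-! ### The mean over a unit interval -/

lemma tendsto_qNumber_atTop {q : ℝ} (hq0 : 0 < q) (hq1 : q < 1) :
    Tendsto (qNumber q) atTop (𝓝 (1 - q)⁻¹) := by
  have := ((tendsto_rpow_atTop_of_base_lt_one q (by linarith) hq1).const_sub 1).div_const (1 - q)
  rw [sub_zero, one_div] at this
  exact this

lemma integral_qSummand {q y : ℝ} (hq0 : 0 < q) (hq1 : q < 1) (hy : 0 < y) (s : ℂ) :
    ∫ x in y..y + 1, (s - 1) * qSummand q s x = ((1 - q : ℝ) : ℂ) / ((Real.log q : ℝ) : ℂ) *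
      (((qNumber q (y + 1) : ℝ) : ℂ) ^ (1 - s) - ((qNumber q y : ℝ) : ℂ) ^ (1 - s)) := by
  have h1 : ((1 - q : ℝ) : ℂ) ≠ 0 := Complex.ofReal_ne_zero.2 (sub_pos.2 hq1).ne'
  have h2 : ((Real.log q : ℝ) : ℂ) ≠ 0 := Complex.ofReal_ne_zero.2 (Real.log_neg hq0 hq1).ne
  have hpos : ∀ x ∈ Set.uIcc y (y + 1), 0 < x := fun x hx => by
    rw [Set.uIcc_of_le (by linarith)] at hx; exact hy.trans_le hx.1
  rw [mul_sub]
  refine intervalIntegral.integral_eq_sub_of_hasDerivAt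
    (f := fun x => ((1 - q : ℝ) : ℂ) / ((Real.log q : ℝ) : ℂ) *
      ((qNumber q x : ℝ) : ℂ) ^ (1 - s)) (fun x hx => ?_) ?_
  · refine ((hasDerivAt_qNumber_cpow hq0 hq1 (hpos x hx) (1 - s)).const_mul _).congr_deriv ?_
    rw [show (1 - s - 1 : ℂ) = -s by ring, Complex.cpow_neg, qSummand]
    rw [Complex.ofReal_mul, Complex.ofReal_div, Complex.ofReal_neg]
    field_simp
    ring
  · refine ContinuousOn.intervalIntegrable fun x hx => ?_
    exact ((hasDerivAt_qSummand hq0 hq1 (hpos x hx) s).continuousAt.const_mul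
      (s - 1)).continuousWithinAt

/-- Each summand has a multiple of `[x]_q^{1-s}` as antiderivative, so the integrated series
telescopes. Its boundary value at infinity, where `[x]_q → 1/(1-q)`, is exactly the correction term
and cancels, leaving a quantity bounded as `q → 1`. -/
lemma integral_qZetaNumer {q a : ℝ} (hq0 : 0 < q) (hq1 : q < 1) (ha : 0 < a) (s : ℂ) :
    ∫ x in a..a + 1, qZetaNumer q s x =
      -(((1 - q : ℝ) : ℂ) / ((Real.log q : ℝ) : ℂ) * ((qNumber q a : ℝ) : ℂ) ^ (1 - s)) := by
  have h1 : ((1 - q : ℝ) : ℂ) ≠ 0 := Complex.ofReal_ne_zero.2 (sub_pos.2 hq1).ne'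
  have hpos : ∀ x ∈ Set.uIoc a (a + 1), a < x := fun x hx => by
    rw [Set.uIoc_of_le (by linarith)] at hx; exact hx.1
  have hpos' : ∀ x ∈ Set.uIcc a (a + 1), 0 < x := fun x hx => by
    rw [Set.uIcc_of_le (by linarith)] at hx; exact ha.trans_le hx.1
  set K : ℂ := ((1 - q : ℝ) : ℂ) / ((Real.log q : ℝ) : ℂ) with hK
  let f : ℕ → ℂ := fun n => ((qNumber q (n + a) : ℝ) : ℂ) ^ (1 - s)
  have hcont : ∀ n : ℕ, ContinuousOn (fun x => (s - 1) * qSummand q s (n + x))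
      (Set.uIcc a (a + 1)) := fun n x hx =>
    (((hasDerivAt_qSummand hq0 hq1 (add_pos_of_nonneg_of_pos n.cast_nonneg (hpos' x hx))
      s).comp_const_add (n : ℝ) x).continuousAt.const_mul (s - 1)).continuousWithinAt
  have hsum : HasSum (fun n : ℕ => ∫ x in a..a + 1, (s - 1) * qSummand q s (n + x))
      (∫ x in a..a + 1, (s - 1) * qHurwitz q s ((1 : ℕ) : ℂ) x) := by
    refine intervalIntegral.hasSum_integral_of_dominated_convergence
      (fun n _ => ‖s - 1‖ * (q ^ n * (min a 1 * (1 - q))⁻¹ ^ ‖s‖)) (fun n => ?_) (fun n => ?_)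
      ?_ ?_ ?_
    · exact ((hcont n).mono Set.uIoc_subset_uIcc).aestronglyMeasurable measurableSet_uIoc
    · refine Eventually.of_forall fun x hx => ?_
      rw [norm_mul]
      gcongr
      exact norm_qSummand_add_le hq0 hq1 (lt_min ha one_pos) (min_le_right _ _)
        ((min_le_left _ _).trans (hpos x hx).le) le_rfl n
    · exact Eventually.of_forall fun x _ => (summable_pow_mul hq0 hq1 _).mul_left _
    · exact intervalIntegrable_const
    · refine Eventually.of_forall fun x hx => ?_
      rw [qHurwitz_one hq0]
      exact (summable_qSummand hq0 hq1 (ha.trans (hpos x hx)) s).hasSum.mul_left _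
  have hterm : ∀ n : ℕ, ∫ x in a..a + 1, (s - 1) * qSummand q s (n + x) =
      K * (f (n + 1) - f n) := fun n => by
    rw [intervalIntegral.integral_comp_add_left (fun x => (s - 1) * qSummand q s x) (n : ℝ),
      ← add_assoc, integral_qSummand hq0 hq1 (add_pos_of_nonneg_of_pos n.cast_nonneg ha)]
    simp only [f]
    rw [Nat.cast_succ, add_right_comm]
  have hlim : Tendsto f atTop (𝓝 (((1 - q : ℝ) : ℂ) ^ (s - 1))) := by
    have hinv : ((1 - q : ℝ) : ℂ) ^ (s - 1) = (((1 - q)⁻¹ : ℝ) : ℂ) ^ (1 - s) := by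
      rw [Complex.ofReal_inv, Complex.inv_cpow, ← Complex.cpow_neg, neg_sub]
      rw [Complex.arg_ofReal_of_nonneg (sub_pos.2 hq1).le]
      exact Real.pi_pos.ne
    rw [hinv]
    have hb : ContinuousAt (fun r : ℝ => (r : ℂ) ^ (1 - s)) (1 - q)⁻¹ :=
      Complex.continuousAt_ofReal_cpow_const _ _ (Or.inr (inv_pos.2 (sub_pos.2 hq1)).ne')
    exact hb.tendsto.comp ((tendsto_qNumber_atTop hq0 hq1).comp
      (tendsto_atTop_add_const_right _ _ tendsto_natCast_atTop_atTop))
  have hval : ∫ x in a..a + 1, (s - 1) * qHurwitz q s ((1 : ℕ) : ℂ) x =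
      K * (((1 - q : ℝ) : ℂ) ^ (s - 1) - f 0) := by
    refine tendsto_nhds_unique hsum.tendsto_sum_nat ?_
    simp only [hterm, ← Finset.mul_sum, Finset.sum_range_sub]
    exact (hlim.sub_const _).const_mul _
  have hint : IntervalIntegrable (fun x => (s - 1) * qHurwitz q s ((1 : ℕ) : ℂ) x)
      MeasureTheory.volume a (a + 1) :=
    ContinuousOn.intervalIntegrable fun x hx =>
      ((hasDerivAt_qHurwitz_one hq0 hq1 (hpos' x hx) s).continuousAt.const_mul
        (s - 1)).continuousWithinAt
  simp only [qZetaNumer]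
  rw [intervalIntegral.integral_sub hint intervalIntegrable_const, hval,
    intervalIntegral.integral_const, add_sub_cancel_left, one_smul, mul_sub, hK,
    Complex.cpow_sub _ _ h1, Complex.cpow_one]
  simp only [f, Nat.cast_zero, zero_add]
  field_simp
  ring

/-! ### Bounds uniform in `q` near 1 -/

/-- Two powers of `[y]_q` absorb `q^y` and give `1 / y ^ 2`; the remaining power `Re s - 2 ≥ 0` is
bounded below through `[y]_q ≥ [a]_q ≥ a`. -/
lemma norm_qSummand_le {q a y ρ : ℝ} {s : ℂ} (hq0 : 0 < q) (hq1 : q < 1) (ha0 : 0 < a)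
    (ha1 : a ≤ 1) (hy : a ≤ y) (hσ : 2 ≤ s.re) (hs : ‖s‖ ≤ ρ) :
    ‖qSummand q s y‖ ≤ a⁻¹ ^ ρ * (1 / y ^ 2) := by
  have hy0 := ha0.trans_le hy
  have hN := qNumber_pos hq0 hq1 hy0
  have hq := Real.rpow_pos_of_pos hq0 y
  rw [qSummand, norm_mul, norm_inv, Complex.norm_cpow_eq_rpow_re_of_pos hN, Complex.norm_real,
    Real.norm_of_nonneg hq.le]
  have h2 : q ^ y * y ^ 2 ≤ qNumber q y ^ 2 := by
    have h := pow_le_pow_left₀ (by positivity) (mul_rpow_half_le_qNumber hq0 hq1 hy0.le) 2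
    rwa [mul_pow, ← Real.rpow_natCast (q ^ (y / 2)), ← Real.rpow_mul hq0.le, Nat.cast_two,
      div_mul_cancel₀ _ two_ne_zero, mul_comm] at h
  have h3 : a ^ ρ ≤ qNumber q y ^ (s.re - 2) := by
    have haN := (le_qNumber hq0 hq1 ha0.le ha1).trans (qNumber_mono hq0 hq1 hy)
    refine le_trans ?_ (Real.rpow_le_rpow ha0.le haN (by linarith))
    exact Real.rpow_le_rpow_of_exponent_ge ha0 ha1 (by linarith [(Complex.re_le_norm s).trans hs])
  have h4 : qNumber q y ^ s.re = qNumber q y ^ (s.re - 2) * qNumber q y ^ 2 := by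
    rw [← Real.rpow_natCast, ← Real.rpow_add hN]; norm_num
  have hpow := Real.rpow_pos_of_pos ha0 ρ
  rw [h4, Real.inv_rpow ha0.le, ← div_eq_mul_inv, div_le_iff₀ (by positivity)]
  calc q ^ y = (a ^ ρ)⁻¹ * (1 / y ^ 2) * (a ^ ρ * (q ^ y * y ^ 2)) := by field_simp
    _ ≤ _ := by gcongr

lemma summable_one_div_nat_add_sq (a : ℝ) :
    Summable fun n : ℕ => 1 / ((n : ℝ) + a) ^ 2 := by
  refine ((Real.summable_one_div_nat_add_rpow a 2).2 one_lt_two).congr fun n => ?_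
  rw [Real.rpow_two, sq_abs]

lemma norm_cpow_div_log_le {q : ℝ} {s : ℂ} (hq0 : 0 < q) (hq1 : q < 1) (hσ : 2 ≤ s.re) :
    ‖((1 - q : ℝ) : ℂ) ^ s / ((Real.log q : ℝ) : ℂ)‖ ≤ 1 - q := by
  have h1 := sub_pos.2 hq1
  have hl := Real.log_neg hq0 hq1
  rw [norm_div, Complex.norm_cpow_eq_rpow_re_of_pos h1, Complex.norm_real,
    Real.norm_of_nonpos hl.le, div_le_iff₀ (neg_pos.2 hl)]
  calc (1 - q) ^ s.re ≤ (1 - q) ^ (2 : ℝ) :=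
        Real.rpow_le_rpow_of_exponent_ge h1 (by linarith) hσ
    _ = (1 - q) * (1 - q) := by rw [Real.rpow_two, sq]
    _ ≤ _ := mul_le_mul_of_nonneg_left (one_sub_le_neg_log hq0) h1.le

lemma norm_qZetaNumer_le_of_two_le_re {q a x ρ : ℝ} {s : ℂ} (hq0 : 0 < q) (hq1 : q < 1)
    (ha0 : 0 < a) (ha1 : a ≤ 1) (hx : a ≤ x) (hσ : 2 ≤ s.re) (hs : ‖s‖ ≤ ρ) :
    ‖qZetaNumer q s x‖ ≤ (ρ + 1) * ∑' n : ℕ, a⁻¹ ^ ρ * (1 / ((n : ℝ) + a) ^ 2) + 1 := by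
  rw [qZetaNumer, qHurwitz_one hq0]
  refine (norm_sub_le _ _).trans (add_le_add ?_
    ((norm_cpow_div_log_le hq0 hq1 hσ).trans (by linarith)))
  rw [norm_mul]
  refine mul_le_mul ((norm_sub_le _ _).trans (by simpa using hs)) ?_ (norm_nonneg _)
    (by linarith [norm_nonneg s])
  refine tsum_of_norm_bounded ((summable_one_div_nat_add_sq a).mul_left _).hasSum fun n => ?_
  have hn : (0 : ℝ) ≤ n := n.cast_nonneg
  refine (norm_qSummand_le hq0 hq1 ha0 ha1 (by linarith) hσ hs).trans ?_
  gcongr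

/-- Let `m` be the maximum of `‖Z_q(s,·)‖` on the interval. The derivative formula bounds the
oscillation by `2(ρ+1)M + m/2`, and the mean is explicit. Thus `m ≤ mean + 2(ρ+1)M + m/2`, and
absorbing `m/2` produces the outer factor 2. -/
lemma norm_qZetaNumer_le_of_shift {q a ρ M : ℝ} {s : ℂ} (hq0 : 1 / 2 < q) (hq1 : q < 1)
    (ha0 : 0 < a) (ha1 : a ≤ 1) (hs : ‖s‖ ≤ ρ) (hlog : -Real.log q * (ρ + 1) ≤ 1 / 2)
    (hM : ∀ x ∈ Set.Icc a (a + 1), ‖qZetaNumer q (s + 1) x‖ ≤ M) :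
    ∀ x ∈ Set.Icc a (a + 1), ‖qZetaNumer q s x‖ ≤ 2 * (a⁻¹ ^ (ρ + 1) + (ρ + 1) * (2 * M)) := by
  have hq : 0 < q := by linarith
  have h1 := sub_pos.2 hq1
  have hl : 0 < -Real.log q := neg_pos.2 (Real.log_neg hq hq1)
  have hd : ∀ x ∈ Set.Icc a (a + 1), HasDerivAt (fun x => qZetaNumer q s x)
      ((s - 1) * ((Real.log q : ℝ) : ℂ) *
        (qZetaNumer q (s + 1) x / ((1 - q : ℝ) : ℂ) - qZetaNumer q s x)) x :=
    fun x hx => hasDerivAt_qZetaNumer hq hq1 (ha0.trans_le hx.1) s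
  have hc : ContinuousOn (fun x => qZetaNumer q s x) (Set.Icc a (a + 1)) :=
    fun x hx => (hd x hx).continuousAt.continuousWithinAt
  obtain ⟨x₀, hx₀, hmax⟩ := isCompact_Icc.exists_isMaxOn
    (Set.nonempty_Icc.2 (by linarith)) hc.norm
  have hmax' : ∀ x ∈ Set.Icc a (a + 1), ‖qZetaNumer q s x‖ ≤ ‖qZetaNumer q s x₀‖ := hmax
  set m := ‖qZetaNumer q s x₀‖ with hm
  have hs1 : ‖s - 1‖ ≤ ρ + 1 := (norm_sub_le _ _).trans (by simpa using hs)
  -- The ratio is at most `1/q`, and `q > 1/2`.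
  have hratio : -Real.log q / (1 - q) ≤ 2 := by
    rw [div_le_iff₀ h1]
    refine (neg_log_le hq).trans ?_
    rw [div_le_iff₀ hq]
    nlinarith
  have hρ : 0 ≤ ρ + 1 := (norm_nonneg _).trans hs1
  have hM0 : 0 ≤ M := (norm_nonneg _).trans (hM x₀ hx₀)
  have hderiv : ∀ x ∈ Set.Icc a (a + 1), ‖(s - 1) * ((Real.log q : ℝ) : ℂ) *
      (qZetaNumer q (s + 1) x / ((1 - q : ℝ) : ℂ) - qZetaNumer q s x)‖ ≤
      (ρ + 1) * (2 * M) + 1 / 2 * m := by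
    intro x hx
    rw [norm_mul, norm_mul, Complex.norm_real, Real.norm_eq_abs, ← abs_neg, abs_of_pos hl]
    have hb : ‖qZetaNumer q (s + 1) x / ((1 - q : ℝ) : ℂ) - qZetaNumer q s x‖ ≤
        M / (1 - q) + m := by
      refine (norm_sub_le _ _).trans (add_le_add ?_ (hmax' x hx))
      rw [norm_div, Complex.norm_real, Real.norm_of_nonneg h1.le]
      gcongr
      exact hM x hx
    calc _ ≤ (ρ + 1) * -Real.log q * (M / (1 - q) + m) := by gcongr
      _ = (ρ + 1) * (-Real.log q / (1 - q) * M) + (-Real.log q * (ρ + 1)) * m := by ring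
      _ ≤ _ := by gcongr
  have hosc : ∀ t ∈ Set.Icc a (a + 1), ‖qZetaNumer q s x₀ - qZetaNumer q s t‖ ≤
      (ρ + 1) * (2 * M) + 1 / 2 * m := by
    intro t ht
    have h := (convex_Icc a (a + 1)).norm_image_sub_le_of_norm_hasDerivWithin_le
      (fun x hx => (hd x hx).hasDerivWithinAt) hderiv ht hx₀
    refine h.trans (mul_le_of_le_one_right (by positivity) ?_)
    rw [Real.norm_eq_abs, abs_le]
    constructor <;> linarith [ht.1, ht.2, hx₀.1, hx₀.2]
  have hmean : ‖∫ x in a..a + 1, qZetaNumer q s x‖ ≤ a⁻¹ ^ (ρ + 1) := by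
    have hN := qNumber_pos hq hq1 ha0
    rw [integral_qZetaNumer hq hq1 ha0, norm_neg, norm_mul, norm_div, Complex.norm_real,
      Complex.norm_real, Complex.norm_cpow_eq_rpow_re_of_pos hN, Real.norm_of_nonneg h1.le,
      Real.norm_eq_abs, ← abs_neg, abs_of_pos hl]
    refine (mul_le_of_le_one_left (Real.rpow_nonneg hN.le _)
      ((div_le_one hl).2 (one_sub_le_neg_log hq))).trans ?_
    have ha' : 1 ≤ a⁻¹ := (one_le_inv₀ ha0).2 ha1
    refine rpow_le_rpow_of_inv_le ha' ?_ ?_ ?_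
    · rw [inv_inv]; exact le_qNumber hq hq1 ha0.le ha1
    · exact ((qNumber_mono hq hq1 ha1).trans (qNumber_one hq1).le).trans ha'
    · refine (Complex.abs_re_le_norm _).trans ?_
      rwa [norm_sub_rev]
  have hint : IntervalIntegrable (fun x => qZetaNumer q s x) MeasureTheory.volume a (a + 1) :=
    ContinuousOn.intervalIntegrable_of_Icc (by linarith) hc
  have hdecomp : qZetaNumer q s x₀ = (∫ x in a..a + 1, qZetaNumer q s x) +
      ∫ x in a..a + 1, (qZetaNumer q s x₀ - qZetaNumer q s x) := by
    rw [intervalIntegral.integral_sub intervalIntegrable_const hint,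
      intervalIntegral.integral_const]
    simp
  have hbound : m ≤ a⁻¹ ^ (ρ + 1) + ((ρ + 1) * (2 * M) + 1 / 2 * m) := by
    rw [hm, hdecomp]
    refine (norm_add_le _ _).trans (add_le_add hmean ?_)
    rw [← hdecomp, ← hm]
    have h := intervalIntegral.norm_integral_le_of_norm_le_const (a := a) (b := a + 1)
      (f := fun x => qZetaNumer q s x₀ - qZetaNumer q s x)
      (C := (ρ + 1) * (2 * M) + 1 / 2 * m) (fun x hx => hosc x (by
        rw [Set.uIoc_of_le (by linarith)] at hx; exact Set.Ioc_subset_Icc_self hx))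
    simpa using h
  intro x hx
  have := hmax' x hx
  linarith

/-- Each induction step moves the half-plane one unit left. Since `s + 1` may have norm up to `ρ +
1`, the radius is quantified inside the induction. -/
lemma exists_norm_qZetaNumer_le {a : ℝ} (ha0 : 0 < a) (ha1 : a ≤ 1) (m : ℕ) :
    ∀ ρ : ℝ, ∃ M : ℝ, ∀ᶠ q : ℝ in 𝓝[<] 1, ∀ s : ℂ, ‖s‖ ≤ ρ → 2 - (m : ℝ) ≤ s.re →
      ∀ x ∈ Set.Icc a (a + 1), ‖qZetaNumer q s x‖ ≤ M := by
  have hhalf : ∀ᶠ q : ℝ in 𝓝[<] 1, 1 / 2 < q :=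
    nhdsWithin_le_nhds (lt_mem_nhds (by norm_num))
  induction m with
  | zero =>
    intro ρ
    refine ⟨(ρ + 1) * ∑' n : ℕ, a⁻¹ ^ ρ * (1 / ((n : ℝ) + a) ^ 2) + 1, ?_⟩
    filter_upwards [hhalf, self_mem_nhdsWithin] with q hq0 (hq1 : q < 1) s hs hσ x hx
    exact norm_qZetaNumer_le_of_two_le_re (by linarith) hq1 ha0 ha1 hx.1 (by simpa using hσ) hs
  | succ m ih =>
    intro ρ
    obtain ⟨M, hM⟩ := ih (ρ + 1)
    refine ⟨2 * (a⁻¹ ^ (ρ + 1) + (ρ + 1) * (2 * M)), ?_⟩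
    have hlog : ∀ᶠ q : ℝ in 𝓝[<] 1, -Real.log q * (ρ + 1) < 1 / 2 := by
      have hc : ContinuousAt (fun q : ℝ => -Real.log q * (ρ + 1)) 1 :=
        (Real.continuousAt_log one_ne_zero).neg.mul continuousAt_const
      exact nhdsWithin_le_nhds (hc.eventually_lt continuousAt_const (by norm_num))
    filter_upwards [hhalf, self_mem_nhdsWithin, hM, hlog] with q hq0 (hq1 : q < 1) hM hlog s hs hσ
    refine norm_qZetaNumer_le_of_shift hq0 hq1 ha0 ha1 hs hlog.le (hM (s + 1) ?_ ?_)
    · exact (norm_add_le _ _).trans (by simpa using hs)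
    · push_cast at hσ
      simp only [Complex.add_re, Complex.one_re]
      linarith

/-! ### A Vitali-type convergence theorem -/

/-- Cauchy's formula writes the derivative as a circle integral, to which dominated convergence
applies. -/
lemma tendsto_iteratedDeriv_zero_of_tendsto_sphere {ι : Type*} {l : Filter ι}
    [l.IsCountablyGenerated] {F : ι → ℂ → ℂ} {c : ℂ} {r M : ℝ} (hr : 0 < r)
    (hF : ∀ᶠ i in l, Differentiable ℂ (F i))
    (hM : ∀ᶠ i in l, ∀ z ∈ Metric.sphere c r, ‖F i z‖ ≤ M)
    (h0 : ∀ z ∈ Metric.sphere c r, Tendsto (fun i => F i z) l (𝓝 0)) (n : ℕ) :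
    Tendsto (fun i => iteratedDeriv n (F i) c) l (𝓝 0) := by
  have hmem : ∀ θ, circleMap c r θ ∈ Metric.sphere c r := circleMap_mem_sphere c hr.le
  have hint : Tendsto (fun i => ∮ z in C(c, r), (1 / (z - c) ^ (n + 1)) • F i z) l (𝓝 0) := by
    have h := intervalIntegral.tendsto_integral_filter_of_dominated_convergence (l := l)
      (a := 0) (b := 2 * Real.pi) (μ := MeasureTheory.volume)
      (F := fun i θ => deriv (circleMap c r) θ •
        ((1 / (circleMap c r θ - c) ^ (n + 1)) • F i (circleMap c r θ)))
      (f := fun _ => 0) (fun _ => r * (1 / r ^ (n + 1) * M)) ?_ ?_ intervalIntegrable_const ?_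
    · simpa [circleIntegral] using h
    · filter_upwards [hF] with i hi
      have hc : Continuous fun θ => deriv (circleMap c r) θ •
          ((1 / (circleMap c r θ - c) ^ (n + 1)) • F i (circleMap c r θ)) := by
        simp only [deriv_circleMap]
        refine ((continuous_circleMap 0 r).mul continuous_const).smul
          (Continuous.smul (continuous_const.div
            (((continuous_circleMap c r).sub continuous_const).pow _) fun θ => ?_)
            (hi.continuous.comp (continuous_circleMap c r)))
        exact pow_ne_zero _ (sub_ne_zero.2 (circleMap_ne_center hr.ne'))
      exact hc.aestronglyMeasurable
    · filter_upwards [hM] with i hi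
      refine Eventually.of_forall fun θ _ => ?_
      rw [norm_smul, norm_smul, deriv_circleMap, norm_mul, Complex.norm_I, mul_one, norm_circleMap_zero,
        abs_of_pos hr, norm_div, norm_one, norm_pow, mem_sphere_iff_norm.1 (hmem θ)]
      gcongr
      exact hi _ (hmem θ)
    · refine Eventually.of_forall fun θ _ => ?_
      simpa using ((h0 _ (hmem θ)).const_smul (1 / (circleMap c r θ - c) ^ (n + 1))).const_smul
        (deriv (circleMap c r) θ)
  have hne : (2 * Real.pi * Complex.I / n.factorial : ℂ) ≠ 0 :=
    div_ne_zero Complex.two_pi_I_ne_zero (by exact_mod_cast n.factorial_ne_zero)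
  have h2 := hint.const_smul (2 * Real.pi * Complex.I / n.factorial : ℂ)⁻¹
  rw [smul_zero] at h2
  refine h2.congr' ?_
  filter_upwards [hF] with i hi
  rw [hi.differentiableOn.circleIntegral_one_div_sub_center_pow_smul hr, inv_smul_smul₀ hne]

/-- A disc version of Vitali's convergence theorem. -/
lemma tendsto_zero_of_bounded_of_tendsto_sphere {ι : Type*} {l : Filter ι}
    [l.IsCountablyGenerated] {F : ι → ℂ → ℂ} {c : ℂ} {r R M : ℝ} (hr : 0 < r) (hrR : r ≤ R)
    (hF : ∀ᶠ i in l, Differentiable ℂ (F i))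
    (hM : ∀ᶠ i in l, ∀ z ∈ Metric.closedBall c R, ‖F i z‖ ≤ M)
    (h0 : ∀ z ∈ Metric.sphere c r, Tendsto (fun i => F i z) l (𝓝 0))
    {z : ℂ} (hz : z ∈ Metric.ball c R) : Tendsto (fun i => F i z) l (𝓝 0) := by
  have hR : 0 < R := hr.trans_le hrR
  have hcoeff := tendsto_iteratedDeriv_zero_of_tendsto_sphere hr hF
    (hM.mono fun i hi w hw =>
      hi w (Metric.closedBall_subset_closedBall hrR (Metric.sphere_subset_closedBall hw))) h0
  have hzR : ‖z - c‖ / R < 1 := (div_lt_one hR).2 (mem_ball_iff_norm.1 hz)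
  -- The Taylor coefficients tend to 0 by the small circle, while Cauchy's estimates on the large
  -- one give a geometric majorant.
  have key := tendsto_tsum_of_dominated_convergence (𝓕 := l)
    (f := fun i n => (n.factorial : ℂ)⁻¹ • (z - c) ^ n • iteratedDeriv n (F i) c)
    (g := fun _ : ℕ => 0) (bound := fun n => M * (‖z - c‖ / R) ^ n)
    ((summable_geometric_of_lt_one (by positivity) hzR).mul_left M)
    (fun n => by
      simpa using ((hcoeff n).const_smul ((z - c) ^ n)).const_smul (n.factorial : ℂ)⁻¹) ?_
  · rw [tsum_zero] at key
    refine key.congr' ?_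
    filter_upwards [hF] with i hi
    exact (Complex.hasSum_taylorSeries_of_entire hi c z).tsum_eq
  · filter_upwards [hF, hM] with i hi hMi n
    have h := Complex.norm_iteratedDeriv_le_of_forall_mem_sphere_norm_le n hR hi.diffContOnCl
      fun w hw => hMi w (Metric.sphere_subset_closedBall hw)
    have hn : (0 : ℝ) < n.factorial := by exact_mod_cast n.factorial_pos
    rw [norm_smul, norm_smul, norm_inv, norm_pow, Complex.norm_natCast]
    calc _ ≤ (n.factorial : ℝ)⁻¹ * (‖z - c‖ ^ n * (n.factorial * M / R ^ n)) := by gcongr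
      _ = _ := by rw [div_pow]; field_simp

/-! ### The limit for `μ = 1` -/

lemma tendsto_qSummand {y : ℝ} (hy : 0 < y) (s : ℂ) :
    Tendsto (fun q => qSummand q s y) (𝓝[<] 1) (𝓝 (1 / (y : ℂ) ^ s)) := by
  have h1 : Tendsto (fun q : ℝ => ((q ^ y : ℝ) : ℂ)) (𝓝[<] 1) (𝓝 1) := by
    have : ContinuousAt (fun q : ℝ => q ^ y) 1 :=
      Real.continuousAt_rpow_const _ _ (Or.inl one_ne_zero)
    have h := (Complex.continuous_ofReal.tendsto _).comp
      (this.tendsto.mono_left (nhdsWithin_le_nhds (s := Set.Iio 1)))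
    simpa [Function.comp_def] using h
  have h2 : Tendsto (fun q : ℝ => ((qNumber q y : ℝ) : ℂ) ^ s) (𝓝[<] 1) (𝓝 ((y : ℂ) ^ s)) :=
    (Complex.continuousAt_ofReal_cpow_const y s (Or.inr hy.ne')).tendsto.comp (tendsto_qNumber y)
  rw [one_div, ← one_mul ((y : ℂ) ^ s)⁻¹]
  refine h1.mul (h2.inv₀ ?_)
  simp [Complex.cpow_eq_zero_iff, hy.ne']

lemma tendsto_qZetaNumer_of_two_le_re {a : ℝ} (ha0 : 0 < a) (ha1 : a ≤ 1) {s : ℂ}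
    (hσ : 2 ≤ s.re) :
    Tendsto (fun q => qZetaNumer q s a) (𝓝[<] 1)
      (𝓝 ((s - 1) * HurwitzZeta.hurwitzZeta (a : UnitAddCircle) s)) := by
  have hpos : ∀ᶠ q : ℝ in 𝓝[<] 1, 0 < q := nhdsWithin_le_nhds (lt_mem_nhds one_pos)
  have hlt : ∀ᶠ q : ℝ in 𝓝[<] 1, q < 1 := self_mem_nhdsWithin
  have hsum : Tendsto (fun q => qHurwitz q s ((1 : ℕ) : ℂ) a) (𝓝[<] 1)
      (𝓝 (HurwitzZeta.hurwitzZeta (a : UnitAddCircle) s)) := by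
    rw [← (HurwitzZeta.hasSum_hurwitzZeta_of_one_lt_re ⟨ha0.le, ha1⟩
      (show 1 < s.re by linarith)).tsum_eq]
    refine (tendsto_tsum_of_dominated_convergence (𝓕 := 𝓝[<] (1 : ℝ))
      (f := fun q (n : ℕ) => qSummand q s (n + a))
      ((summable_one_div_nat_add_sq a).mul_left (a⁻¹ ^ ‖s‖)) (fun n => ?_) ?_).congr' ?_
    · have := tendsto_qSummand (add_pos_of_nonneg_of_pos (n.cast_nonneg (α := ℝ)) ha0) s
      simpa only [Complex.ofReal_add, Complex.ofReal_natCast] using this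
    · filter_upwards [hpos, hlt] with q hq0 hq1 n
      exact norm_qSummand_le hq0 hq1 ha0 ha1 (by linarith [n.cast_nonneg (α := ℝ)]) hσ le_rfl
    · filter_upwards [hpos] with q hq0
      exact (qHurwitz_one hq0 s a).symm
  have hcorr : Tendsto (fun q : ℝ => ((1 - q : ℝ) : ℂ) ^ s / ((Real.log q : ℝ) : ℂ)) (𝓝[<] 1)
      (𝓝 0) := by
    refine squeeze_zero_norm' (a := fun q : ℝ => 1 - q) ?_ ?_
    · filter_upwards [hpos, hlt] with q hq0 hq1
      exact norm_cpow_div_log_le hq0 hq1 hσ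
    · have : Tendsto (fun q : ℝ => 1 - q) (𝓝 1) (𝓝 (1 - 1)) := tendsto_id.const_sub 1
      rw [sub_self] at this
      exact this.mono_left nhdsWithin_le_nhds
  simpa [qZetaNumer] using (hsum.const_mul (s - 1)).sub hcorr

/-- `(s - 1) ζ(s, a)` with its value `1` at the removable singularity `s = 1`. -/
noncomputable def hurwitzZetaNumer (a : UnitAddCircle) : ℂ → ℂ :=
  Function.update (fun s => (s - 1) * HurwitzZeta.hurwitzZeta a s) 1 1

lemma hurwitzZetaNumer_of_ne (a : UnitAddCircle) {s : ℂ} (hs : s ≠ 1) :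
    hurwitzZetaNumer a s = (s - 1) * HurwitzZeta.hurwitzZeta a s :=
  Function.update_of_ne hs _ _

lemma differentiable_hurwitzZetaNumer (a : UnitAddCircle) :
    Differentiable ℂ (hurwitzZetaNumer a) := by
  have hd : ∀ s : ℂ, s ≠ 1 → DifferentiableAt ℂ (hurwitzZetaNumer a) s := fun s hs => by
    have h : DifferentiableAt ℂ (fun s => (s - 1) * HurwitzZeta.hurwitzZeta a s) s :=
      (differentiableAt_id.sub_const 1).mul (HurwitzZeta.differentiableAt_hurwitzZeta a hs)
    refine h.congr_of_eventuallyEq ?_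
    filter_upwards [isOpen_ne.mem_nhds hs] with z hz
    exact hurwitzZetaNumer_of_ne a hz
  intro s
  rcases eq_or_ne s 1 with rfl | hs
  · refine (Complex.analyticAt_of_differentiable_on_punctured_nhds_of_continuousAt ?_
      ?_).differentiableAt
    · filter_upwards [self_mem_nhdsWithin] with z hz
      exact hd z hz
    · exact continuousAt_update_same.2 (HurwitzZeta.hurwitzZeta_residue_one a)
  · exact hd s hs

lemma tendsto_qZetaNumer {a : ℝ} (ha0 : 0 < a) (ha1 : a ≤ 1) (s : ℂ) :
    Tendsto (fun q => qZetaNumer q s a) (𝓝[<] 1) (𝓝 (hurwitzZetaNumer (a : UnitAddCircle) s)) := by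
  have hpos : ∀ᶠ q : ℝ in 𝓝[<] 1, 0 < q := nhdsWithin_le_nhds (lt_mem_nhds one_pos)
  have hlt : ∀ᶠ q : ℝ in 𝓝[<] 1, q < 1 := self_mem_nhdsWithin
  set H := hurwitzZetaNumer (a : UnitAddCircle) with hH
  have hHd : Differentiable ℂ H := differentiable_hurwitzZetaNumer _
  set R : ℝ := ‖s - 3‖ + 2 with hR
  -- The unit circle about 3 lies in `Re z ≥ 2`, where convergence is known. The closed ball of
  -- radius `R` about 3 satisfies `‖z‖ ≤ R + 3` and `Re z ≥ 3 - R ≥ 2 - ⌈R⌉₊`.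
  obtain ⟨M₁, hM₁⟩ := exists_norm_qZetaNumer_le ha0 ha1 ⌈R⌉₊ (R + 3)
  obtain ⟨M₂, hM₂⟩ := (isCompact_closedBall (3 : ℂ) R).exists_bound_of_continuousOn
    hHd.continuous.continuousOn
  have hlim := tendsto_zero_of_bounded_of_tendsto_sphere (l := 𝓝[<] (1 : ℝ))
    (F := fun q z => qZetaNumer q z a - H z) (c := 3) (r := 1) (R := R) (M := M₁ + M₂) (z := s)
    one_pos (by linarith [norm_nonneg (s - 3)]) ?_ ?_ ?_
    (mem_ball_iff_norm.2 (by linarith))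
  · simpa using hlim.add_const (H s)
  · filter_upwards [hpos, hlt] with q hq0 hq1
    exact (differentiable_qZetaNumer hq0 hq1 ha0).sub hHd
  · filter_upwards [hM₁] with q hq z hz
    refine (norm_sub_le _ _).trans (add_le_add (hq z ?_ ?_ a ⟨le_rfl, by linarith⟩) (hM₂ z hz))
    · have := norm_add_le (z - 3) 3
      rw [sub_add_cancel, Complex.norm_ofNat] at this
      linarith [mem_closedBall_iff_norm.1 hz]
    · have h := (Complex.abs_re_le_norm (z - 3)).trans (mem_closedBall_iff_norm.1 hz)
      have h' := (abs_le.1 h).1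
      simp only [Complex.sub_re, Complex.re_ofNat] at h'
      linarith [Nat.le_ceil R]
  · intro z hz
    have h := (Complex.abs_re_le_norm (z - 3)).trans (mem_sphere_iff_norm.1 hz).le
    have h' := (abs_le.1 h).1
    simp only [Complex.sub_re, Complex.re_ofNat] at h'
    have hz1 : z ≠ 1 := by rintro rfl; norm_num at h'
    rw [hH, hurwitzZetaNumer_of_ne _ hz1]
    simpa using (tendsto_qZetaNumer_of_two_le_re ha0 ha1 (by linarith : 2 ≤ z.re)).sub_const
      ((z - 1) * HurwitzZeta.hurwitzZeta (a : UnitAddCircle) z)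

lemma tendsto_qHurwitzZeta_one {a : ℝ} (ha0 : 0 < a) (ha1 : a ≤ 1) {s : ℂ} (hs : s ≠ 1) :
    Tendsto (fun q => qHurwitzZeta q 1 s a) (𝓝[<] 1)
      (𝓝 (HurwitzZeta.hurwitzZeta (a : UnitAddCircle) s)) := by
  have h := (tendsto_qZetaNumer ha0 ha1 s).const_mul (s - 1)⁻¹
  have hs1 : s - 1 ≠ 0 := sub_ne_zero.2 hs
  simpa only [qZetaNumer_eq _ _ hs, hurwitzZetaNumer_of_ne _ hs, inv_mul_cancel_left₀ hs1] using h

/-! ### From `μ` to `μ + 1` -/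

lemma qHurwitzTerm_succ {q a : ℝ} (hq0 : 0 < q) (hq1 : q < 1) (ha : 0 < a) (μ : ℕ) (s : ℂ)
    (n : ℕ) : qHurwitzTerm q s ((μ + 1 : ℕ) : ℂ) a n = qHurwitzTerm q s (μ : ℂ) a n -
      ((1 - q : ℝ) : ℂ) * qHurwitzTerm q (s - 1) (μ : ℂ) a n := by
  set y : ℝ := n + a with hy
  have hN : ((qNumber q y : ℝ) : ℂ) ≠ 0 :=
    Complex.ofReal_ne_zero.2 (qNumber_pos hq0 hq1 (add_pos_of_nonneg_of_pos n.cast_nonneg ha)).ne'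
  have hu : ((q ^ y : ℝ) : ℂ) = 1 - ((1 - q : ℝ) : ℂ) * ((qNumber q y : ℝ) : ℂ) := by
    have : q ^ y = 1 - (1 - q) * qNumber q y := by
      rw [qNumber, mul_div_cancel₀ _ (sub_pos.2 hq1).ne']; ring
    exact_mod_cast congrArg (fun r : ℝ => (r : ℂ)) this
  rw [qHurwitzTerm_natCast hq0, qHurwitzTerm_natCast hq0, qHurwitzTerm_natCast hq0, ← hy, pow_succ,
    Complex.cpow_sub _ _ hN, Complex.cpow_one, inv_div]
  nth_rewrite 2 [hu]
  rw [div_eq_mul_inv]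
  ring

/-- The series obey the termwise recursion. For the correction terms, over the common denominator
`(1-s)_{μ+1}` the numerators differ by `(1-s+μ) - (1-s) = μ`, which turns `(μ-1)!` into `μ!`. -/
lemma qHurwitzZeta_succ {q a : ℝ} {μ : ℕ} (hμ : 1 ≤ μ) (hq0 : 0 < q) (hq1 : q < 1) (ha : 0 < a)
    {s : ℂ} (hs : ∀ k ∈ Finset.Icc 1 (μ + 1), s ≠ (k : ℂ)) :
    qHurwitzZeta q (μ + 1) s a =
      qHurwitzZeta q μ s a - ((1 - q : ℝ) : ℂ) * qHurwitzZeta q μ (s - 1) a := by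
  have h1 : ((1 - q : ℝ) : ℂ) ≠ 0 := Complex.ofReal_ne_zero.2 (sub_pos.2 hq1).ne'
  have hsum : qHurwitz q s ((μ + 1 : ℕ) : ℂ) a =
      qHurwitz q s (μ : ℂ) a - ((1 - q : ℝ) : ℂ) * qHurwitz q (s - 1) (μ : ℂ) a := by
    rw [qHurwitz, tsum_congr (qHurwitzTerm_succ hq0 hq1 ha μ s), Summable.tsum_sub, tsum_mul_left]
    · rfl
    · exact (summable_norm_qHurwitzTerm hμ hq0 hq1 ha s).of_norm
    · exact (summable_norm_qHurwitzTerm hμ hq0 hq1 ha (s - 1)).of_norm.mul_left _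
  have hX : (ascPochhammer ℂ (μ + 1)).eval (1 - s) ≠ 0 := by
    rw [ascPochhammer_eval_one_sub]
    exact mul_ne_zero (by simp) (prod_sub_natCast_ne_zero hs)
  have hA : (ascPochhammer ℂ (μ + 1)).eval (1 - s) =
      (ascPochhammer ℂ μ).eval (1 - s) * (1 - s + μ) := ascPochhammer_succ_eval _ _
  have hB : (ascPochhammer ℂ (μ + 1)).eval (1 - s) =
      (1 - s) * (ascPochhammer ℂ μ).eval (1 - (s - 1)) := by
    rw [ascPochhammer_succ_left]
    simp only [Polynomial.eval_mul, Polynomial.eval_X, Polynomial.eval_comp, Polynomial.eval_add,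
      Polynomial.eval_one]
    congr 2
    ring
  have hA0 := hA ▸ hX
  have hB0 := hB ▸ hX
  have hfac : (μ.factorial : ℂ) = μ * ((μ - 1).factorial : ℂ) := by
    exact_mod_cast (Nat.mul_factorial_pred (by omega)).symm
  have hinvA : ((ascPochhammer ℂ μ).eval (1 - s))⁻¹ =
      (1 - s + μ) / (ascPochhammer ℂ (μ + 1)).eval (1 - s) := by
    rw [hA, div_mul_cancel_right₀ (right_ne_zero_of_mul hA0)]
  have hinvB : ((ascPochhammer ℂ μ).eval (1 - (s - 1)))⁻¹ =
      (1 - s) / (ascPochhammer ℂ (μ + 1)).eval (1 - s) := by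
    rw [hB, div_mul_cancel_left₀ (left_ne_zero_of_mul hB0)]
  rw [qHurwitzZeta, qHurwitzZeta, qHurwitzZeta, hsum, Nat.add_sub_cancel, hfac,
    div_eq_mul_inv _ ((ascPochhammer ℂ μ).eval (1 - s)),
    div_eq_mul_inv _ ((ascPochhammer ℂ μ).eval (1 - (s - 1))), hinvA, hinvB,
    Complex.cpow_sub _ _ h1, Complex.cpow_one]
  field_simp
  ring

lemma tendsto_qHurwitzZeta {a : ℝ} (ha0 : 0 < a) (ha1 : a ≤ 1) {μ : ℕ} (hμ : 1 ≤ μ) :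
    ∀ s : ℂ, (∀ k ∈ Finset.Icc 1 μ, s ≠ (k : ℂ)) →
      Tendsto (fun q => qHurwitzZeta q μ s a) (𝓝[<] 1)
        (𝓝 (HurwitzZeta.hurwitzZeta (a : UnitAddCircle) s)) := by
  induction μ, hμ using Nat.le_induction with
  | base => exact fun s hs => tendsto_qHurwitzZeta_one ha0 ha1 (by simpa using hs 1 (by simp))
  | succ μ hμ ih =>
    intro s hs
    have h1 := ih s fun k hk => hs k (by rw [Finset.mem_Icc] at hk ⊢; omega)
    -- The shifted function has its poles at `2, …, μ + 1`, all excluded, so it converges and the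
    -- factor `1 - q` annihilates it.
    have h2 := ih (s - 1) fun k hk h => hs (k + 1) (by rw [Finset.mem_Icc] at hk ⊢; omega)
      (by push_cast; rw [← h]; ring)
    have h3 : Tendsto (fun q : ℝ => ((1 - q : ℝ) : ℂ)) (𝓝[<] 1) (𝓝 0) := by
      have : Continuous fun q : ℝ => ((1 - q : ℝ) : ℂ) := by fun_prop
      exact (this.tendsto' 1 0 (by simp)).mono_left nhdsWithin_le_nhds
    have h := h1.sub (h3.mul h2)
    rw [zero_mul, sub_zero] at h
    refine h.congr' ?_
    filter_upwards [nhdsWithin_le_nhds (lt_mem_nhds one_pos), self_mem_nhdsWithin]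
      with q hq0 (hq1 : q < 1)
    exact (qHurwitzZeta_succ hμ hq0 hq1 ha0 hs).symm

theorem mainTheorem4 (μ : ℕ) (hμ : 1 ≤ μ) (a : ℝ) (ha0 : 0 < a) (ha1 : a ≤ 1) :
    -- for every `0 < q < 1` ...
    (∀ q : ℝ, 0 < q → q < 1 →
      -- the series for `g_q(s,μ,a)` converges absolutely for every `s`
      (∀ s : ℂ, Summable (fun n : ℕ => ‖qHurwitzTerm q s (μ : ℂ) a n‖)) ∧
      -- the second expression for `ζ_q^μ(s,a)`
      (∀ s : ℂ, (∀ k ∈ Finset.Icc 1 μ, s ≠ (k : ℂ)) →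
        qHurwitzZeta q μ s a =
          (-1 : ℂ) ^ μ * ((μ - 1).factorial : ℂ) / (∏ k ∈ Finset.Icc 1 μ, (s - (k : ℂ))) *
              (((1 - q : ℝ) : ℂ) ^ s / ((Real.log q : ℝ) : ℂ)) +
            ∑' n : ℕ, (q : ℂ) ^ ((μ : ℂ) * ((n : ℂ) + (a : ℂ))) /
              ((qNumber q ((n : ℝ) + a) : ℝ) : ℂ) ^ s) ∧
      -- meromorphic on `ℂ`, with simple poles at `1, …, μ` and no other poles
      Meromorphic (fun s : ℂ => qHurwitzZeta q μ s a) ∧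
      (∀ k ∈ Finset.Icc 1 μ,
        meromorphicOrderAt (fun s : ℂ => qHurwitzZeta q μ s a) (k : ℂ) = ((-1 : ℤ) : WithTop ℤ)) ∧
      (∀ s : ℂ, (∀ k ∈ Finset.Icc 1 μ, s ≠ (k : ℂ)) →
        AnalyticAt ℂ (fun s : ℂ => qHurwitzZeta q μ s a) s)) ∧
    -- the classical limit `q ↑ 1`
    (∀ s : ℂ, (∀ k ∈ Finset.Icc 1 μ, s ≠ (k : ℂ)) →
      Tendsto (fun q : ℝ => qHurwitzZeta q μ s a) (𝓝[<] 1)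
        (𝓝 (HurwitzZeta.hurwitzZeta (a : UnitAddCircle) s))) := by
  refine ⟨fun q hq0 hq1 => ⟨summable_norm_qHurwitzTerm hμ hq0 hq1 ha0, fun s _ => ?_,
    meromorphic_qHurwitzZeta hμ hq0 hq1 ha0,
    fun k hk => meromorphicOrderAt_qHurwitzZeta hμ hq0 hq1 ha0 hk,
    fun s hs => analyticAt_qHurwitzZeta hμ hq0 hq1 ha0 hs⟩, tendsto_qHurwitzZeta ha0 ha1 hμ⟩
  simp only [qHurwitzZeta_eq_prod, qHurwitz, qHurwitzTerm, mul_comm (μ : ℂ)]
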